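/- Let $n\ge 1$ be an integer, let $\mathcal{M}_n$ be the space of all complex $n\times n$ matrices, and for $x\in\mathcal{M}_n$ let $\rho(x)$ denote its spectral radius, that is, the maximum of $|\lambda|$ over the eigenvalues $\lambda\in\mathbb{C}$ of $x$. Let $T:\mathcal{M}_n\to\mathcal{M}_n$ be an $\mathbb{R}$-linear map such that $\rho(T(x))=\rho(x)$ for all $x\in\mathcal{M}_n$. Then $T$ or $\overline{T}$ is $\mathbb{C}$-linear, where $\overline{T}:\mathcal{M}_n\to\mathcal{M}_n$ is defined by $\overline{T}(x)=\overline{T(x)}$, the matrix obtained from $T(x)$ by entrywise complex conjugation. -/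

import Mathlib

/-! Suppose first that `T` fixes scalar matrices. Then `a + x` and `a + T x` have equal spectral
radii for every scalar `a`, and large discs touching the spectrum of `x` only at an exposed point
show that this point is an eigenvalue of `T x` (`Matrix.mem_spectrum_of_exposed`). Pushing `x` far
along a direction that gives its eigenvalues distinct unit velocities exposes them all, so `x` and
`T x` have equal traces of squares, first far out and then, by polynomiality, everywhere
(`trace_mul_self_map`). Polarised, `T` preserves the nondegenerate `ℂ`-bilinear trace form, hence
commutes with `i`.

For the reduction, scalars are recognised by how the spectrum responds to square-zero perturbations
(`Matrix.exists_eq_smul_one_of_spectrum_bounded`); so `T` is bijective and sends scalars to scalars.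
Moduli force `T i = ± i T 1`, and conjugation removes the minus sign. -/

/-! ### Moving eigenvalues and traces of squares -/

open Matrix Polynomial in
/-- Every complex matrix `x` has a direction `d` along which its eigenvalues move linearly, with
prescribed velocities `e`. -/
theorem exists_charpoly_add_smul_eq_prod (n : ℕ) : ∀ (x : Matrix (Fin n) (Fin n) ℂ) (e : Fin n → ℂ),
    ∃ (d : Matrix (Fin n) (Fin n) ℂ) (u : Fin n → ℂ), ∀ t : ℂ,
      (x + t • d).charpoly = ∏ i, (X - C (u i + t * e i)) := by
  induction n with
  | zero =>
    intro x e
    exact ⟨0, 0, fun t => by simp [Matrix.charpoly]⟩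
  | succ n ih =>
    intro x e
    obtain ⟨μ, hμ⟩ := Module.End.exists_eigenvalue (Matrix.toLin' x)
    obtain ⟨v, hv⟩ := hμ.exists_hasEigenvector
    have hxv : x *ᵥ v = μ • v := by simpa using hv.apply_eq_smul
    have he : (Pi.single 0 1 : Fin (n + 1) → ℂ) ≠ 0 := by simp
    obtain ⟨A, hA⟩ := SeparatingDual.exists_continuousLinearEquiv_apply_eq (R := ℂ) he hv.2
    set L := A.toLinearEquiv
    have hL : L (Pi.single 0 1) = v := hA
    set g := LinearMap.toMatrix' L.toLinearMap with hg
    set g' := LinearMap.toMatrix' L.symm.toLinearMap with hg'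
    have hgv : g' *ᵥ v = Pi.single 0 1 := by
      rw [hg', LinearMap.toMatrix'_mulVec, ← hL]
      simp
    have hge : g *ᵥ Pi.single 0 1 = v := by
      rw [hg, LinearMap.toMatrix'_mulVec]
      exact hL
    have hgg' : g * g' = 1 := by
      rw [← LinearMap.toMatrix'_comp, LinearEquiv.comp_symm, LinearMap.toMatrix'_id]
    have hg'g : g' * g = 1 := by
      rw [← LinearMap.toMatrix'_comp, LinearEquiv.symm_comp, LinearMap.toMatrix'_id]
    obtain ⟨y, hy⟩ : ∃ y, y = g' * x * g := ⟨_, rfl⟩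
    have hxy : x = g * y * g' := by
      rw [hy, show g * (g' * x * g) * g' = (g * g') * x * (g * g') by simp only [mul_assoc], hgg']
      simp
    have hy0 : ∀ i : Fin n, y i.succ 0 = 0 := by
      intro i
      have h : y *ᵥ Pi.single 0 1 = μ • Pi.single 0 1 := by
        rw [hy, ← mulVec_mulVec, ← mulVec_mulVec, hge, hxv, mulVec_smul, hgv]
      simpa using congrFun h i.succ
    let ε : Fin (n + 1) ≃ Fin n ⊕ Unit := (finSuccEquiv n).trans (Equiv.optionEquivSumPUnit _)
    obtain ⟨d', u', hd⟩ := ih (y.submatrix Fin.succ Fin.succ) (fun i => e i.succ)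
    -- Block diagonal, so `y + t • d₀` stays block triangular and its characteristic polynomial
    -- factors.
    let d₀ : Matrix (Fin (n + 1)) (Fin (n + 1)) ℂ :=
      (fromBlocks d' 0 0 (of fun _ _ => e 0)).submatrix ε ε
    refine ⟨g * d₀ * g', Fin.cons (y 0 0) u', fun t => ?_⟩
    have h1 : x + t • (g * d₀ * g') = g * (y + t • d₀) * g' := by
      rw [hxy]
      simp [mul_add, add_mul]
    have h2 : y + t • d₀ = (fromBlocks (y.submatrix Fin.succ Fin.succ + t • d') 0
        (of fun _ j => y 0 j.succ) (of fun _ _ => y 0 0 + t * e 0)).submatrix ε ε := by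
      ext i j
      refine Fin.cases ?_ (fun i => ?_) i <;> refine Fin.cases ?_ (fun j => ?_) j <;>
        simp [d₀, ε, hy0]
    have h3 := charpoly_units_conj (⟨g, g', hgg', hg'g⟩ : (Matrix _ _ ℂ)ˣ) (y + t • d₀)
    have h4 := charpoly_reindex ε.symm (fromBlocks (y.submatrix Fin.succ Fin.succ + t • d') 0
        (of fun _ j => y 0 j.succ) (of fun _ _ => y 0 0 + t * e 0))
    have h5 : (g : Matrix _ _ ℂ)⁻¹ = g' := Matrix.inv_eq_right_inv hgg'
    rw [reindex_apply, Equiv.symm_symm, ← h2, charpoly_fromBlocks_zero₁₂, hd] at h4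
    rw [h1, Fin.prod_univ_succ]
    simp only [h5] at h3
    refine h3.trans (h4.trans ?_)
    rw [mul_comm]
    congr 1
    simp [Matrix.charpoly]

/-- A matrix with distinct eigenvalues `l i` satisfies `tr (A ^ 2) = ∑ (l i) ^ 2`. -/
theorem Matrix.trace_mul_self_of_injective_eigenvalues {ι : Type*} [Fintype ι] [DecidableEq ι]
    [Nonempty ι] (A : Matrix ι ι ℂ) (l : ι → ℂ) (hl : Function.Injective l)
    (h : ∀ i, l i ∈ spectrum ℂ A) : (A * A).trace = ∑ i, l i ^ 2 := by
  have hev : ∀ i, ∃ v, Module.End.HasEigenvector (Matrix.toLin' A) (l i) v := fun i => by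
    have := h i
    rw [← Matrix.spectrum_toLin', ← Module.End.hasEigenvalue_iff_mem_spectrum] at this
    exact this.exists_hasEigenvector
  choose v hv using hev
  have hli := Module.End.eigenvectors_linearIndependent' _ l hl v hv
  let b := basisOfLinearIndependentOfCardEqFinrank hli (by simp)
  have hb : ∀ i, Matrix.toLin' (A * A) (b i) = l i ^ 2 • b i := by
    intro i
    have h1 : Matrix.toLin' A (b i) = l i • b i := by
      simpa [b] using (hv i).apply_eq_smul
    rw [Matrix.toLin'_mul, LinearMap.comp_apply, h1, map_smul, h1, smul_smul, sq]
  rw [← Matrix.trace_toLin'_eq, LinearMap.trace_eq_matrix_trace ℂ b, Matrix.trace]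
  refine Finset.sum_congr rfl fun i _ => ?_
  rw [Matrix.diag_apply, LinearMap.toMatrix_apply, hb]
  simp

theorem Matrix.norm_trace_mul_self_le {ι : Type*} [Fintype ι] [DecidableEq ι]
    (A : Matrix ι ι ℂ) (r : ℝ) (h : ∀ μ ∈ spectrum ℂ A, ‖μ‖ ≤ r) :
    ‖(A * A).trace‖ ≤ Fintype.card ι * r ^ 2 := by
  rw [Matrix.trace_eq_sum_roots_charpoly]
  refine (norm_multiset_sum_le _).trans ?_
  have hcard : (A * A).charpoly.roots.card = Fintype.card ι := by
    rw [← (IsAlgClosed.splits (A * A).charpoly).natDegree_eq_card_roots,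
      Matrix.charpoly_natDegree_eq_dim]
  have := Multiset.sum_le_card_nsmul ((A * A).charpoly.roots.map fun x => ‖x‖) (r ^ 2) ?_
  · simpa [hcard] using this
  · intro a ha
    obtain ⟨μ, hμ, rfl⟩ := Multiset.mem_map.1 ha
    have h1 : μ ∈ spectrum ℂ (A ^ 2) := by
      rw [Matrix.mem_spectrum_iff_isRoot_charpoly, sq]
      exact Polynomial.isRoot_of_mem_roots hμ
    rw [spectrum.map_pow_of_pos _ two_pos] at h1
    obtain ⟨k, hk, rfl⟩ := h1
    simpa using pow_le_pow_left₀ (norm_nonneg k) (h k hk) 2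

/-! ### Comparing spectral radii -/

theorem Matrix.exists_norm_le_of_spectralRadius_le {ι : Type*} [Fintype ι] [DecidableEq ι]
    [Nonempty ι] {A B : Matrix ι ι ℂ} (h : spectralRadius ℂ B ≤ spectralRadius ℂ A) {μ : ℂ}
    (hμ : μ ∈ spectrum ℂ B) : ∃ k ∈ spectrum ℂ A, ‖μ‖ ≤ ‖k‖ := by
  obtain ⟨k, hk, hmax⟩ := Set.exists_max_image (spectrum ℂ A) (fun z => ‖z‖) A.finite_spectrum
    (spectrum.nonempty_of_isAlgClosed_of_finiteDimensional ℂ A)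
  refine ⟨k, hk, ?_⟩
  have h1 : (‖μ‖₊ : ENNReal) ≤ ‖k‖₊ := by
    refine (le_iSup₂ (f := fun z (_ : z ∈ spectrum ℂ B) => (‖z‖₊ : ENNReal)) μ hμ).trans
      (h.trans (iSup₂_le fun z hz => ?_))
    exact_mod_cast hmax z hz
  exact_mod_cast h1

theorem spectralRadius_le_of_exists_norm_le {A B : Type*} [Ring A] [Algebra ℂ A] [Ring B]
    [Algebra ℂ B] {a : A} {b : B}
    (h : ∀ μ ∈ spectrum ℂ b, ∃ k ∈ spectrum ℂ a, ‖μ‖ ≤ ‖k‖) :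
    spectralRadius ℂ b ≤ spectralRadius ℂ a := by
  refine iSup₂_le fun μ hμ => ?_
  obtain ⟨k, hk, hle⟩ := h μ hμ
  exact le_trans (by exact_mod_cast hle)
    (le_iSup₂ (f := fun z (_ : z ∈ spectrum ℂ a) => (‖z‖₊ : ENNReal)) k hk)

theorem Matrix.map_starRingEnd_involutive {m n : Type*} :
    Function.LeftInverse (fun A : Matrix m n ℂ => A.map (starRingEnd ℂ))
      (fun A : Matrix m n ℂ => A.map (starRingEnd ℂ)) := fun A => by
  ext; simp

theorem Matrix.conj_mem_spectrum_map {ι : Type*} [Fintype ι] [DecidableEq ι] {A : Matrix ι ι ℂ}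
    {μ : ℂ} (h : μ ∈ spectrum ℂ A) :
    starRingEnd ℂ μ ∈ spectrum ℂ (A.map (starRingEnd ℂ)) := by
  rw [Matrix.mem_spectrum_iff_isRoot_charpoly] at h ⊢
  rw [Matrix.charpoly_map]
  exact h.map

theorem Matrix.spectralRadius_map_conj {ι : Type*} [Fintype ι] [DecidableEq ι]
    (A : Matrix ι ι ℂ) : spectralRadius ℂ (A.map (starRingEnd ℂ)) = spectralRadius ℂ A := by
  refine le_antisymm (spectralRadius_le_of_exists_norm_le fun μ hμ => ?_)
    (spectralRadius_le_of_exists_norm_le fun μ hμ => ?_)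
  · refine ⟨_, ?_, (Complex.norm_conj μ).ge⟩
    have := Matrix.conj_mem_spectrum_map hμ
    rwa [show (A.map (starRingEnd ℂ)).map (starRingEnd ℂ) = A from
      Matrix.map_starRingEnd_involutive A] at this
  · exact ⟨_, Matrix.conj_mem_spectrum_map hμ, (Complex.norm_conj μ).ge⟩

theorem spectralRadius_smul_le_of_norm_eq_one {A : Type*} [Ring A] [Algebra ℂ A] (a : A) {c : ℂ}
    (hc : ‖c‖ = 1) : spectralRadius ℂ (c • a) ≤ spectralRadius ℂ a := by
  have hc0 : c ≠ 0 := norm_ne_zero_iff.1 (by simp [hc])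
  refine spectralRadius_le_of_exists_norm_le fun μ hμ => ?_
  have h := spectrum.unit_smul_eq_smul (R := ℂ) a (Units.mk0 c hc0)
  rw [Units.smul_mk0] at h
  rw [h] at hμ
  obtain ⟨k, hk, rfl⟩ := hμ
  exact ⟨k, hk, by simp [hc]⟩

theorem spectralRadius_smul_of_norm_eq_one {A : Type*} [Ring A] [Algebra ℂ A] (a : A) {c : ℂ}
    (hc : ‖c‖ = 1) : spectralRadius ℂ (c • a) = spectralRadius ℂ a := by
  have hc0 : c ≠ 0 := norm_ne_zero_iff.1 (by simp [hc])
  refine le_antisymm (spectralRadius_smul_le_of_norm_eq_one a hc) ?_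
  have h := spectralRadius_smul_le_of_norm_eq_one (c • a) (c := c⁻¹) (by simp [hc])
  rwa [inv_smul_smul₀ hc0] at h

theorem spectrum.eq_zero_of_sq_eq_zero {A : Type*} [Ring A] [Algebra ℂ A] [Nontrivial A] {a : A}
    (h : a * a = 0) {μ : ℂ} (hμ : μ ∈ spectrum ℂ a) : μ = 0 := by
  have h1 := spectrum.pow_mem_pow a 2 hμ
  rw [sq a, h, spectrum.zero_eq] at h1
  simpa using h1

/-! ### Recognising scalar matrices -/

/-- A matrix `B` such that `B + t M` has bounded spectrum, for every `M` of square zero, is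
scalar. -/
theorem Matrix.exists_eq_smul_one_of_spectrum_bounded {ι : Type*} [Fintype ι] [DecidableEq ι]
    [Nonempty ι] (B : Matrix ι ι ℂ) (r : ℝ)
    (h : ∀ M : Matrix ι ι ℂ, M * M = 0 → ∀ t : ℝ, ∀ μ ∈ spectrum ℂ (B + t • M), ‖μ‖ ≤ r) :
    ∃ c : ℂ, B = c • 1 := by
  have htr : ∀ M : Matrix ι ι ℂ, M * M = 0 → (B * M).trace = 0 := by
    intro M hM
    by_contra hne
    have hpos : 0 < ‖(B * M).trace‖ := norm_pos_iff.2 hne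
    set K := Fintype.card ι * r ^ 2 + ‖(B * B).trace‖
    -- As `M * M = 0`, the trace of `(B + t • M) ^ 2` is affine in `t`; being bounded, it has slope
    -- zero.
    have key : ∀ t : ℝ, ‖2 * (t : ℂ) * (B * M).trace‖ ≤ K := by
      intro t
      have h1 := Matrix.norm_trace_mul_self_le _ r (h M hM t)
      have h2 : ((B + t • M) * (B + t • M)).trace
          = (B * B).trace + 2 * (t : ℂ) * (B * M).trace := by
        have : (M * B).trace = (B * M).trace := Matrix.trace_mul_comm _ _
        simp [add_mul, mul_add, hM, this]
        ring
      rw [h2] at h1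
      have h3 := norm_sub_le ((B * B).trace + 2 * (t : ℂ) * (B * M).trace) (B * B).trace
      rw [add_sub_cancel_left] at h3
      linarith
    have h4 := key ((K + 1) / ‖(B * M).trace‖)
    rw [norm_mul, norm_mul, Complex.norm_real, Real.norm_eq_abs, abs_of_nonneg (by positivity),
      Complex.norm_ofNat, mul_assoc, div_mul_cancel₀ _ hpos.ne'] at h4
    have : 0 ≤ K := by positivity
    linarith
  have hoff : ∀ i j, i ≠ j → B i j = 0 := by
    intro i j hij
    simpa [Matrix.trace_mul_single] using htr (Matrix.single j i 1) (by simp [hij])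
  have hdiag : ∀ i j, B i i = B j j := by
    intro i j
    rcases eq_or_ne i j with rfl | hij
    · rfl
    -- The square-zero block with rows `(1, -1)` and `(1, -1)` compares the two diagonal entries.
    have := htr (Matrix.single i i 1 - Matrix.single i j 1 + Matrix.single j i 1
      - Matrix.single j j 1) (by simp [mul_add, mul_sub, add_mul, sub_mul, hij, hij.symm]; abel)
    simp [mul_add, mul_sub, Matrix.trace_mul_single, hoff _ _ hij, hoff _ _ hij.symm] at this
    exact sub_eq_zero.1 this
  refine ⟨B (Classical.arbitrary ι) (Classical.arbitrary ι), ?_⟩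
  ext i j
  rcases eq_or_ne i j with rfl | hij
  · simp [hdiag i (Classical.arbitrary ι)]
  · simp [hij, hoff i j hij]

/-! ### Exposed eigenvalues -/

theorem Complex.sq_norm_add_real_mul (w e : ℂ) (r : ℝ) (he : ‖e‖ = 1) :
    ‖w + r * e‖ ^ 2 = ‖w‖ ^ 2 + 2 * r * (starRingEnd ℂ e * w).re + r ^ 2 := by
  have h1 : e.re * e.re + e.im * e.im = 1 := by
    rw [← Complex.normSq_apply, ← Complex.sq_norm, he, one_pow]
  rw [Complex.sq_norm, Complex.sq_norm, Complex.normSq_apply, Complex.normSq_apply]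
  simp
  linear_combination r ^ 2 * h1

theorem Complex.re_conj_mul_lt_one {z w : ℂ} (hz : ‖z‖ = 1) (hw : ‖w‖ = 1) (hne : z ≠ w) :
    (starRingEnd ℂ z * w).re < 1 := by
  have h1 := Complex.sq_norm_add_real_mul w z (-1) hz
  have h2 : 0 < ‖w + ((-1 : ℝ) : ℂ) * z‖ ^ 2 := by
    have : w + ((-1 : ℝ) : ℂ) * z ≠ 0 := by
      intro h
      apply hne
      push_cast at h
      linear_combination -h
    positivity
  rw [hw] at h1
  linarith

theorem Matrix.mem_spectrum_smul_one_add {ι : Type*} [Fintype ι] [DecidableEq ι]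
    (A : Matrix ι ι ℂ) (a μ : ℂ) :
    μ ∈ spectrum ℂ (a • (1 : Matrix ι ι ℂ) + A) ↔ μ - a ∈ spectrum ℂ A := by
  rw [← Algebra.algebraMap_eq_smul_one, ← spectrum.singleton_add_eq]
  simp [sub_eq_neg_add]

/-- If `a + A` and `a + B` have the same spectral radius for all scalars `a`, then every
exposed point of the convex hull of the spectrum of `A` is an eigenvalue of `B`. -/
theorem Matrix.mem_spectrum_of_exposed {ι : Type*} [Fintype ι] [DecidableEq ι] [Nonempty ι]
    {A B : Matrix ι ι ℂ}
    (h : ∀ a : ℂ, spectralRadius ℂ (a • (1 : Matrix ι ι ℂ) + B)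
      = spectralRadius ℂ (a • (1 : Matrix ι ι ℂ) + A))
    {l e : ℂ} (he : ‖e‖ = 1) (hl : l ∈ spectrum ℂ A)
    (hexp : ∀ k ∈ spectrum ℂ A, k ≠ l → (starRingEnd ℂ e * k).re < (starRingEnd ℂ e * l).re) :
    l ∈ spectrum ℂ B := by
  -- For large `r`, the disc of radius `r` about `l - r * e` contains the spectrum of `A`, with `l`
  -- on its boundary.
  have hev : ∀ᶠ r : ℝ in Filter.atTop, ∀ k ∈ spectrum ℂ A, ‖k - l + r * e‖ ≤ r := by
    rw [Filter.eventually_all_finite A.finite_spectrum]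
    intro k hk
    rcases eq_or_ne k l with rfl | hkl
    · filter_upwards [Filter.eventually_ge_atTop 0] with r hr
      simp [he, abs_of_nonneg hr]
    · have hneg : (starRingEnd ℂ e * (k - l)).re < 0 := by
        rw [mul_sub, Complex.sub_re]
        linarith [hexp k hk hkl]
      filter_upwards [Filter.eventually_ge_atTop 0,
        Filter.eventually_ge_atTop (‖k - l‖ ^ 2 / (-2 * (starRingEnd ℂ e * (k - l)).re))]
        with r hr hr'
      refine le_of_sq_le_sq ?_ hr
      rw [Complex.sq_norm_add_real_mul _ _ _ he]
      rw [div_le_iff₀ (by linarith)] at hr'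
      linarith
  obtain ⟨R, hR⟩ := Filter.eventually_atTop.1 hev
  have hex : ∀ m : ℕ, ∃ μ : spectrum ℂ B, ‖(μ : ℂ) - l‖ ^ 2
      + 2 * (max R 0 + m) * (starRingEnd ℂ e * (μ - l)).re = 0 := by
    intro m
    obtain ⟨r, hr⟩ : ∃ r : ℝ, r = max R 0 + m := ⟨_, rfl⟩
    have hrR : R ≤ r := hr ▸ (le_max_left R 0).trans (by simp)
    have hr0 : 0 ≤ r := hr ▸ by positivity
    have h1 : (r * e : ℂ) ∈ spectrum ℂ ((r * e - l) • (1 : Matrix ι ι ℂ) + A) := by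
      rw [Matrix.mem_spectrum_smul_one_add]
      simpa using hl
    obtain ⟨ν, hν, hle⟩ := Matrix.exists_norm_le_of_spectralRadius_le (h _).ge h1
    obtain ⟨k, hk, hle'⟩ := Matrix.exists_norm_le_of_spectralRadius_le (h _).le hν
    rw [Matrix.mem_spectrum_smul_one_add] at hk hν
    have h2 := hR r hrR _ hk
    refine ⟨⟨_, hν⟩, ?_⟩
    rw [show k - (r * e - l) - l + r * e = k by ring] at h2
    rw [norm_mul, he, Complex.norm_real, Real.norm_eq_abs, abs_of_nonneg hr0, mul_one] at hle
    have h3 : ‖ν‖ = r := le_antisymm (hle'.trans h2) hle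
    have h4 := Complex.sq_norm_add_real_mul (ν - (r * e - l) - l) e r he
    rw [show ν - (r * e - l) - l + r * e = ν by ring, h3] at h4
    simp only [← hr]
    linarith
  choose f hf using hex
  have : Finite (spectrum ℂ B) := B.finite_spectrum
  -- Each of these circles carries an eigenvalue of `B`, so two of them share one; they are tangent
  -- and meet only at `l`.
  obtain ⟨p, q, hpq, hfpq⟩ := Finite.exists_ne_map_eq_of_infinite f
  have hp := hf p
  have hq := hf q
  rw [← hfpq] at hq
  have hpq' : (p : ℝ) - q ≠ 0 := sub_ne_zero.2 (by exact_mod_cast hpq)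
  have hre : (starRingEnd ℂ e * (f p - l)).re = 0 := by
    have : ((p : ℝ) - q) * (starRingEnd ℂ e * (f p - l)).re = 0 := by
      linear_combination (hp - hq) / 2
    exact (mul_eq_zero.1 this).resolve_left hpq'
  rw [hre, mul_zero, add_zero, sq_eq_zero_iff, norm_eq_zero, sub_eq_zero] at hp
  exact hp ▸ (f p).2

theorem Complex.exists_injective_norm_eq_one (n : ℕ) :
    ∃ e : Fin n → ℂ, Function.Injective e ∧ ∀ i, ‖e i‖ = 1 := by
  have hinf : Infinite Circle := by
    have : Infinite (Set.Ioc (-Real.pi) Real.pi) :=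
      (Set.Ioc_infinite (by linarith [Real.pi_pos])).to_subtype
    exact Infinite.of_injective _ Circle.argEquiv.symm.injective
  let φ := Infinite.natEmbedding Circle
  exact ⟨fun i => φ i, fun i j hij => Fin.ext (φ.injective (Circle.ext hij)),
    fun i => Circle.norm_coe _⟩

/-! ### Maps fixing the scalars, or multiplying them by a unit -/

open Matrix Polynomial in
theorem trace_mul_self_map {n : ℕ} (hn : 1 ≤ n)
    (T : Matrix (Fin n) (Fin n) ℂ →ₗ[ℝ] Matrix (Fin n) (Fin n) ℂ)
    (hT : ∀ x, spectralRadius ℂ (T x) = spectralRadius ℂ x)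
    (h1 : ∀ a : ℂ, T (a • 1) = a • 1) (x : Matrix (Fin n) (Fin n) ℂ) :
    (T x * T x).trace = (x * x).trace := by
  have : Nonempty (Fin n) := ⟨⟨0, hn⟩⟩
  obtain ⟨e, hinj, he⟩ := Complex.exists_injective_norm_eq_one n
  obtain ⟨d, u, hd⟩ := exists_charpoly_add_smul_eq_prod n x e
  have hev : ∀ᶠ t : ℝ in Filter.atTop, ∀ i j, i ≠ j →
      (starRingEnd ℂ (e i) * (u j + t * e j)).re < (starRingEnd ℂ (e i) * (u i + t * e i)).re := by
    refine Filter.eventually_all.2 fun i => Filter.eventually_all.2 fun j => ?_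
    by_cases hij : i = j
    · simp [hij]
    have hlt := Complex.re_conj_mul_lt_one (he i) (he j) (hinj.ne hij)
    have hii : (starRingEnd ℂ (e i) * e i).re = 1 := by
      rw [Complex.conj_mul', he i]
      simp
    filter_upwards [Filter.eventually_gt_atTop
      (((starRingEnd ℂ (e i) * u j).re - (starRingEnd ℂ (e i) * u i).re)
        / (1 - (starRingEnd ℂ (e i) * e j).re))] with t ht _
    rw [div_lt_iff₀ (by linarith)] at ht
    have hre : ∀ k, (starRingEnd ℂ (e i) * (u k + t * e k)).re
        = (starRingEnd ℂ (e i) * u k).re + t * (starRingEnd ℂ (e i) * e k).re := by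
      intro k
      rw [← Complex.re_ofReal_mul, ← Complex.add_re]
      congr 1
      ring
    rw [hre, hre, hii]
    linarith
  obtain ⟨R, hR⟩ := Filter.eventually_atTop.1 hev
  have key : ∀ t : ℝ, R ≤ t →
      (T x * T x).trace - (x * x).trace + t * (2 * ((T x * T d).trace - (x * d).trace))
        + t ^ 2 * ((T d * T d).trace - (d * d).trace) = 0 := by
    intro t ht
    have hlt := hR t ht
    have hspec : ∀ k, k ∈ spectrum ℂ (x + t • d) ↔ ∃ i, u i + t * e i = k := by
      intro k
      rw [Matrix.mem_spectrum_iff_isRoot_charpoly, ← Complex.coe_smul, hd, IsRoot.def, eval_prod,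
        Finset.prod_eq_zero_iff]
      simp [sub_eq_zero, eq_comm]
    have hli : Function.Injective fun i => u i + t * e i := by
      intro i j hij
      by_contra hne
      have := hlt i j hne
      simp only at hij
      rw [hij] at this
      exact lt_irrefl _ this
    have hmem : ∀ i, u i + t * e i ∈ spectrum ℂ (T (x + t • d)) := by
      intro i
      refine Matrix.mem_spectrum_of_exposed (A := x + t • d) (fun a => ?_) (he i)
        ((hspec _).2 ⟨i, rfl⟩) fun k hk hne => ?_
      · rw [← hT (a • 1 + (x + t • d)), map_add T (a • 1), h1]
      · obtain ⟨j, rfl⟩ := (hspec k).1 hk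
        exact hlt i j fun hij => hne (by rw [hij])
    have heq := (Matrix.trace_mul_self_of_injective_eigenvalues _ _ hli hmem).trans
      (Matrix.trace_mul_self_of_injective_eigenvalues _ _ hli fun i => (hspec _).2 ⟨i, rfl⟩).symm
    have hc1 := Matrix.trace_mul_comm (T d) (T x)
    have hc2 := Matrix.trace_mul_comm d x
    simp only [map_add, map_smul, add_mul, mul_add, Matrix.trace_add, smul_mul_assoc,
      mul_smul_comm, Matrix.trace_smul, Complex.real_smul, hc1, hc2] at heq
    linear_combination heq
  have k0 := key R le_rfl
  have k1 := key (R + 1) (by linarith)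
  have k2 := key (R + 2) (by linarith)
  push_cast at k0 k1 k2
  -- Lagrange interpolation at `t = 0` from the nodes `R`, `R + 1`, `R + 2`.
  linear_combination ((R + 1) * (R + 2) / 2 : ℂ) * k0 - (R * (R + 2) : ℂ) * k1
    + (R * (R + 1) / 2 : ℂ) * k2

theorem map_I_smul_of_map_smul_one {n : ℕ} (hn : 1 ≤ n)
    (T : Matrix (Fin n) (Fin n) ℂ →ₗ[ℝ] Matrix (Fin n) (Fin n) ℂ)
    (hT : ∀ x, spectralRadius ℂ (T x) = spectralRadius ℂ x) (hs : Function.Surjective T)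
    (h1 : ∀ a : ℂ, T (a • 1) = a • 1) (x : Matrix (Fin n) (Fin n) ℂ) :
    T (Complex.I • x) = Complex.I • T x := by
  have hq := trace_mul_self_map hn T hT h1
  have hpol : ∀ y z, (T y * T z).trace = (y * z).trace := by
    intro y z
    have h2 := hq (y + z)
    have hc1 := Matrix.trace_mul_comm (T z) (T y)
    have hc2 := Matrix.trace_mul_comm z y
    simp only [map_add, add_mul, mul_add, Matrix.trace_add, hq, hc1, hc2] at h2
    linear_combination h2 / 2
  rw [Matrix.ext_iff_trace_mul_left]
  intro w
  obtain ⟨z, rfl⟩ := hs w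
  simp [hpol]

theorem map_smul_of_map_smul_one {n : ℕ} (hn : 1 ≤ n)
    (T : Matrix (Fin n) (Fin n) ℂ →ₗ[ℝ] Matrix (Fin n) (Fin n) ℂ)
    (hT : ∀ x, spectralRadius ℂ (T x) = spectralRadius ℂ x) (hs : Function.Surjective T)
    {c : ℂ} (hc : ‖c‖ = 1) (h1 : T 1 = c • 1)
    (hI : T (Complex.I • 1) = (Complex.I * c) • 1) (a : ℂ) (x : Matrix (Fin n) (Fin n) ℂ) :
    T (a • x) = a • T x := by
  have hc0 : c ≠ 0 := norm_ne_zero_iff.1 (by simp [hc])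
  have hsplit : ∀ (S : Matrix (Fin n) (Fin n) ℂ →ₗ[ℝ] Matrix (Fin n) (Fin n) ℂ) (a : ℂ) y,
      S (a • y) = a.re • S y + a.im • S (Complex.I • y) := by
    intro S a y
    rw [← map_smul, ← map_smul, ← map_add]
    congr 1
    conv_lhs => rw [← Complex.re_add_im a]
    rw [add_smul, mul_smul, Complex.coe_smul, Complex.coe_smul]
  have key := map_I_smul_of_map_smul_one hn (c⁻¹ • T)
    (fun x => by
      rw [LinearMap.smul_apply, spectralRadius_smul_of_norm_eq_one _ (by simp [hc]), hT])
    (fun y => by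
      obtain ⟨z, hz⟩ := hs (c • y)
      exact ⟨z, by rw [LinearMap.smul_apply, hz, inv_smul_smul₀ hc0]⟩)
    (fun a => by
      rw [LinearMap.smul_apply, hsplit, h1, hI]
      rw [← Complex.coe_smul, ← Complex.coe_smul, smul_smul, smul_smul, ← add_smul, smul_smul]
      congr 1
      conv_rhs => rw [← Complex.re_add_im a]
      field_simp) x
  rw [LinearMap.smul_apply, LinearMap.smul_apply, smul_comm] at key
  have hIx := smul_right_injective _ (inv_ne_zero hc0) key
  rw [hsplit, hIx]
  conv_rhs => rw [← Complex.re_add_im a]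
  rw [add_smul, mul_smul, Complex.coe_smul, Complex.coe_smul]

/-! ### Bijectivity and the image of the scalars -/

theorem injective_of_spectralRadius_map_eq {n : ℕ} (hn : 1 ≤ n)
    (T : Matrix (Fin n) (Fin n) ℂ →ₗ[ℝ] Matrix (Fin n) (Fin n) ℂ)
    (hT : ∀ x, spectralRadius ℂ (T x) = spectralRadius ℂ x) : Function.Injective T := by
  have : Nonempty (Fin n) := ⟨⟨0, hn⟩⟩
  rw [injective_iff_map_eq_zero]
  intro x hx
  have hb : ∀ M : Matrix (Fin n) (Fin n) ℂ, M * M = 0 → ∀ t : ℝ,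
      ∀ μ ∈ spectrum ℂ (x + t • M), ‖μ‖ ≤ 0 := by
    intro M hM t μ hμ
    have hρ : spectralRadius ℂ (x + t • M) = spectralRadius ℂ (t • M) := by
      rw [← hT, map_add, hx, zero_add, hT]
    obtain ⟨k, hk, hle⟩ := Matrix.exists_norm_le_of_spectralRadius_le hρ.le hμ
    rw [spectrum.eq_zero_of_sq_eq_zero (by simp [hM]) hk] at hle
    simpa using hle
  obtain ⟨c, rfl⟩ := Matrix.exists_eq_smul_one_of_spectrum_bounded x 0 hb
  have h0 := hb 0 (by simp) 0 c (by
    rw [zero_smul, Matrix.mem_spectrum_smul_one_add]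
    simp [spectrum.zero_eq])
  simp [norm_le_zero_iff.1 h0]

theorem exists_map_smul_one_eq {n : ℕ} (hn : 1 ≤ n)
    (T : Matrix (Fin n) (Fin n) ℂ →ₗ[ℝ] Matrix (Fin n) (Fin n) ℂ)
    (hT : ∀ x, spectralRadius ℂ (T x) = spectralRadius ℂ x) (hs : Function.Surjective T) (a : ℂ) :
    ∃ c : ℂ, T (a • 1) = c • 1 := by
  have : Nonempty (Fin n) := ⟨⟨0, hn⟩⟩
  refine Matrix.exists_eq_smul_one_of_spectrum_bounded _ ‖a‖ fun M hM t μ hμ => ?_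
  obtain ⟨N, rfl⟩ := hs M
  have hρ : spectralRadius ℂ (T (a • 1) + t • T N) = spectralRadius ℂ (a • 1 + t • N) := by
    rw [← hT (a • 1 + t • N), map_add, map_smul T t]
  obtain ⟨k, hk, hle⟩ := Matrix.exists_norm_le_of_spectralRadius_le hρ.le hμ
  rw [Matrix.mem_spectrum_smul_one_add] at hk
  -- `T N` squares to zero, so `N` has spectral radius zero and `a • 1 + t • N` has only the
  -- eigenvalue `a`.
  have hρ' : spectralRadius ℂ (t • N) = spectralRadius ℂ (t • T N) := by
    rw [← hT, map_smul]
  obtain ⟨j, hj, hle'⟩ := Matrix.exists_norm_le_of_spectralRadius_le hρ'.le hk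
  rw [spectrum.eq_zero_of_sq_eq_zero (by simp [hM]) hj, norm_zero, norm_le_zero_iff,
    sub_eq_zero] at hle'
  rwa [hle'] at hle

/-- The third norm condition says that `c` and `d` are orthogonal in the real plane. -/
theorem Complex.eq_I_mul_or_of_norm {c d : ℂ} (hc : ‖c‖ = 1) (hd : ‖d‖ = 1)
    (hcd : ‖c + d‖ = ‖(1 + Complex.I : ℂ)‖) : d = Complex.I * c ∨ d = -Complex.I * c := by
  have h1 : c.re * c.re + c.im * c.im = 1 := by
    rw [← Complex.normSq_apply, ← Complex.sq_norm, hc, one_pow]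
  have h2 : d.re * d.re + d.im * d.im = 1 := by
    rw [← Complex.normSq_apply, ← Complex.sq_norm, hd, one_pow]
  have h3 := congrArg (· ^ 2) hcd
  simp only [Complex.sq_norm, Complex.normSq_apply, Complex.add_re, Complex.add_im, Complex.one_re,
    Complex.I_re, Complex.one_im, Complex.I_im] at h3
  have h4 : c.re * d.re + c.im * d.im = 0 := by linarith
  obtain ⟨s, hs⟩ : ∃ s, s = c.re * d.im - c.im * d.re := ⟨_, rfl⟩
  have hre : d.re = -s * c.im := by
    rw [hs]; linear_combination (-d.re) * h1 + c.re * h4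
  have him : d.im = s * c.re := by
    rw [hs]; linear_combination (-d.im) * h1 + c.im * h4
  have hs2 : s ^ 2 = 1 := by
    rw [hre, him] at h2
    linear_combination h2 - s ^ 2 * h1
  rcases mul_eq_zero.1 (show (s - 1) * (s + 1) = 0 by linear_combination hs2) with h | h
  · left
    apply Complex.ext <;> simp [hre, him, sub_eq_zero.1 h]
  · right
    apply Complex.ext <;> simp [hre, him, eq_neg_of_add_eq_zero_left h]

theorem corollary1 (n : ℕ) (hn : 1 ≤ n)
    (T : Matrix (Fin n) (Fin n) ℂ →ₗ[ℝ] Matrix (Fin n) (Fin n) ℂ)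
    (hT : ∀ x : Matrix (Fin n) (Fin n) ℂ, spectralRadius ℂ (T x) = spectralRadius ℂ x) :
    IsLinearMap ℂ (fun x : Matrix (Fin n) (Fin n) ℂ => T x) ∨
      IsLinearMap ℂ (fun x : Matrix (Fin n) (Fin n) ℂ => (T x).map (starRingEnd ℂ)) := by
  have : Nonempty (Fin n) := ⟨⟨0, hn⟩⟩
  have hs : Function.Surjective T :=
    LinearMap.injective_iff_surjective.1 (injective_of_spectralRadius_map_eq hn T hT)
  have hnorm : ∀ a c : ℂ, T (a • 1) = c • 1 → ‖c‖ = ‖a‖ := by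
    intro a c hac
    have h := hT (a • 1)
    rw [hac, ← Algebra.algebraMap_eq_smul_one, ← Algebra.algebraMap_eq_smul_one, spectralRadius,
      spectralRadius, spectrum.scalar_eq, spectrum.scalar_eq] at h
    simpa [← NNReal.coe_inj] using h
  obtain ⟨c, hc⟩ := exists_map_smul_one_eq hn T hT hs 1
  obtain ⟨d, hd⟩ := exists_map_smul_one_eq hn T hT hs Complex.I
  have hc1 : ‖c‖ = 1 := by simpa using hnorm _ _ hc
  have hd1 : ‖d‖ = 1 := by simpa using hnorm _ _ hd
  have hcd := hnorm (1 + Complex.I) (c + d) (by rw [add_smul, map_add, hc, hd, add_smul])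
  rw [one_smul] at hc
  rcases Complex.eq_I_mul_or_of_norm hc1 hd1 hcd with rfl | rfl
  · exact Or.inl ⟨map_add T, map_smul_of_map_smul_one hn T hT hs hc1 hc hd⟩
  · right
    -- Conjugation turns `-i * c` into `i` times the conjugate of `c`, so `S` falls under the first
    -- case.
    let S : Matrix (Fin n) (Fin n) ℂ →ₗ[ℝ] Matrix (Fin n) (Fin n) ℂ :=
      { toFun := fun x => (T x).map (starRingEnd ℂ)
        map_add' := fun x y => by ext; simp
        map_smul' := fun r x => by ext; simp }
    have hconj : ∀ z : ℂ, (z • (1 : Matrix (Fin n) (Fin n) ℂ)).map (starRingEnd ℂ)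
        = starRingEnd ℂ z • 1 := by
      intro z
      ext i j
      by_cases hij : i = j <;> simp [hij]
    refine ⟨map_add S, map_smul_of_map_smul_one hn S
      (fun x => (Matrix.spectralRadius_map_conj _).trans (hT x))
      (fun y => ?_) (c := starRingEnd ℂ c) (by simpa using hc1) ?_ ?_⟩
    · obtain ⟨z, hz⟩ := hs (y.map (starRingEnd ℂ))
      exact ⟨z, (congrArg (fun A => A.map (starRingEnd ℂ)) hz).trans
        (Matrix.map_starRingEnd_involutive y)⟩
    · change (T 1).map (starRingEnd ℂ) = _
      rw [hc, hconj]
    · change (T (Complex.I • 1)).map (starRingEnd ℂ) = _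
      rw [hd, hconj]
      simp
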